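/- Let $G=(\mathcal V,\mathcal E)$ be a finite connected multigraph, i.e. a graph with simple edges in which self-loops are allowed; write $u - v$ if $\{u,v\}\in\mathcal E$. Let $\mathcal V_2$ be the set of nodes without a self-loop, and for $U\subset\mathcal V$ put $\mathcal E(U)=\{v\in\mathcal V : \exists u\in U,\ u - v\}$. Let $\check G$ be the maximal subgraph of $G$, obtained by deleting all self-loops, and let $\mathbb I(G)$, $\mathbb I(\check G)$ be the sets of non-empty independent sets of $G$ and of $\check G$ (sets of nodes containing no edge; in particular the elements of $\mathbb I(G)$ contain no node with a self-loop). Let $\mathscr M(\mathcal V)$ be the set of probability measures on $\mathcal V$ with exact support $\mathcal V$, and $$\textsc{Ncond}(G)=\{\mu\in\mathscr M(\mathcal V) : \mu(I)<\mu(\mathcal E(I))\ \text{ for all } I\in\mathbb I(G)\}.$$ Items whose classes $V_1,V_2,\dots$ are i.i.d. with law $\mu\in\mathscr M(\mathcal V)$ arrive one by one. Under the policy First Come, First Matched (FCFM), an arriving item of class $v$ is matched with the oldest item in the buffer whose class $u$ satisfies $u - v$, and both leave; if there is no such item, the arriving item is stored at the end of the line. The buffer content $W_n$ is the word of the classes of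 the stored items after the $n$-th arrival, in order of arrival. It is a Markov chain on the set $\mathbb W$ of the finite words over $\mathcal V$ in which two distinct adjacent classes never both occur and a class with a self-loop occurs at most once; $\varepsilon$ is the empty word. Let $\textsc{Stab}(G,\textsc{fcfm})$ be the set of all $\mu\in\mathscr M(\mathcal V)$ for which $(W_n)$ is positive recurrent. Suppose that $G$ is not a bipartite graph (that is, $G$ has a self-loop, or it has none and is not bipartite). Then FCFM is maximal: $$\textsc{Stab}(G,\textsc{fcfm})=\textsc{Ncond}(G).$$ Moreover, for every $\mu\in\textsc{Ncond}(G)$ the chain $(W_n)$ has a unique stationary probability $\Pi_W$ on $\mathbb W$, and it is given by $$\Pi_W(\varepsilon)=\alpha,\qquad \Pi_W(w)=\alpha\prod_{l=1}^{q}\frac{\mu(w_l)}{\mu(\mathcal E(\{w_1,\dots,w_l\}))}\quad\text{for } w=w_1\cdots w_q\in\mathbb W\setminus\{\varepsilon\},$$ where, writing $I=\{e_1,\dots,e_{|I|}\}$ for $I\in\mathbb I(\check G)$ and $\mathfrak S_k$ for the set of permutations of $\{1,\dots,k\}$, $$\alpha^{-1}=1+\sum_{I\in\mathbb I(\check G)}\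 \sum_{\sigma\in\mathfrak S_{|I|}}\ \prod_{i=1}^{|I|}\frac{\mu(e_{\sigma(i)})}{\mu(\mathcal E(\{e_{\sigma(1)},\dots,e_{\sigma(i)}\}))-\mu(\{e_{\sigma(1)},\dots,e_{\sigma(i)}\}\cap\mathcal V_2)}.$$ -/

import Mathlib

open scoped ENNReal Finset
open MeasureTheory

noncomputable section

open scoped Classical

/-- A multigraph on the vertex set `V`: self-loops are allowed, all edges are simple.
The relation `G.Adj u v` says that `{u, v}` is an edge (a self-loop if `u = v`). -/
structure Multigraph (V : Type*) where
  Adj : V → V → Prop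
  symm : ∀ u v, Adj u v → Adj v u

namespace Multigraph

variable {V : Type*}

/-- Any two nodes are joined by a path of edges (and there is at least one node). -/
def Connected (G : Multigraph V) : Prop :=
  Nonempty V ∧ ∀ u v : V, Relation.ReflTransGen G.Adj u v

/-- The maximal subgraph `Ǧ`: the simple graph obtained by deleting all self-loops. -/
def maxSubgraph (G : Multigraph V) : SimpleGraph V where
  Adj u v := u ≠ v ∧ G.Adj u v
  symm := ⟨fun _ _ h => ⟨h.1.symm, G.symm _ _ h.2⟩⟩
  loopless := ⟨fun _ h => h.1 rfl⟩

/-- `G` is a graph (it has no self-loop), and this graph is bipartite. -/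
def IsBipartiteGraph (G : Multigraph V) : Prop :=
  (∀ v, ¬ G.Adj v v) ∧ G.maxSubgraph.IsBipartite

/-- Admissible queue details: two distinct compatible classes are never both present, and a class
with a self-loop is present at most once. -/
def IsQueueDetail (G : Multigraph V) (w : List V) : Prop :=
  (∀ i j, i ≠ j → G.Adj i j → w.count i * w.count j = 0) ∧ ∀ i, G.Adj i i → w.count i ≤ 1

/-- The state space `𝕎` of admissible queue details. -/
abbrev QueueDetail (G : Multigraph V) : Type _ := {w : List V // G.IsQueueDetail w}

/-- The First Come, First Matched update of a word: the incoming `v`-item is matched with the oldest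
compatible item (which leaves), and is stored at the end of the line if there is none. -/
def fcfmWord (G : Multigraph V) (w : List V) (v : V) : List V :=
  if ∃ u ∈ w, G.Adj u v then w.eraseP (fun u => decide (G.Adj u v)) else w ++ [v]

theorem IsQueueDetail.fcfmWord {G : Multigraph V} {w : List V} (hw : G.IsQueueDetail w) (v : V) :
    G.IsQueueDetail (G.fcfmWord w v) := by
  unfold Multigraph.fcfmWord
  split_ifs with h
  · have hle : ∀ i, (w.eraseP (fun u => decide (G.Adj u v))).count i ≤ w.count i :=
      fun i => List.eraseP_sublist.count_le i
    refine ⟨fun i j hij ha => ?_, fun i hi => (hle i).trans (hw.2 i hi)⟩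
    exact Nat.le_zero.1 ((Nat.mul_le_mul (hle i) (hle j)).trans (hw.1 i j hij ha).le)
  · have h0 : ∀ u, G.Adj u v → w.count u = 0 := fun u hu =>
      List.count_eq_zero.2 fun hm => h ⟨u, hm, hu⟩
    refine ⟨fun i j hij ha => ?_, fun i hi => ?_⟩
    · by_cases hj : v = j
      · subst hj
        simp [h0 i ha, Ne.symm hij]
      · by_cases hi : v = i
        · subst hi
          simp [h0 j (G.symm _ _ ha), hj]
        · simpa [List.count_append, List.count_singleton, hi, hj] using hw.1 i j hij ha
    · by_cases hv : v = i
      · subst hv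
        simp [h0 v hi]
      · simpa [List.count_append, List.count_singleton, hv] using hw.2 i hi

/-- A (deterministic) matching policy, given by its action on queue details:
`Φ w v` is the new queue detail if a `v`-item arrives at the queue detail `w`. -/
abbrev Policy (G : Multigraph V) : Type _ := G.QueueDetail → V → G.QueueDetail

/-- The policy First Come, First Matched. -/
def fcfm (G : Multigraph V) : G.Policy := fun w v => ⟨G.fcfmWord w.1 v, w.2.fcfmWord v⟩

/-- The buffer content `W_n` at time `n`, started from `w`; the `n`-th item (`n ≥ 1`) has
class `a (n - 1)`. -/
def buffer {G : Multigraph V} (Φ : G.Policy) (w : G.QueueDetail) (a : ℕ → V) : ℕ → G.QueueDetail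
  | 0 => w
  | n + 1 => Φ (buffer Φ w a n) (a n)

/-- The first return time to `w` of the buffer content started from `w` (`∞` if it does not
return). -/
def returnTime {G : Multigraph V} (Φ : G.Policy) (w : G.QueueDetail) (a : ℕ → V) : ℝ≥0∞ :=
  ⨅ (n : ℕ) (_ : 1 ≤ n ∧ buffer Φ w a n = w), (n : ℝ≥0∞)

/-- The law of the i.i.d. sequence of the classes of the arriving items. -/
def arrivals [MeasurableSpace V] (μ : PMF V) : Measure (ℕ → V) :=
  Measure.infinitePi fun _ : ℕ => μ.toMeasure

/-- The buffer-content chain is positive recurrent: the mean return time of every state is finite. -/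
def PositiveRecurrent [MeasurableSpace V] {G : Multigraph V} (Φ : G.Policy) (μ : PMF V) : Prop :=
  ∀ w : G.QueueDetail, ∫⁻ a, returnTime Φ w a ∂(arrivals μ) < ∞

/-- The set `ℳ(V)` of the probability measures with exact support `V`. -/
def exactSupport (V : Type*) : Set (PMF V) := {μ | μ.support = Set.univ}

/-- The stability region. -/
def Stab [MeasurableSpace V] (G : Multigraph V) (Φ : G.Policy) : Set (PMF V) :=
  {μ | μ ∈ exactSupport V ∧ PositiveRecurrent Φ μ}

/-- `π` is a stationary probability of the buffer-content chain. -/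
def IsStationary {G : Multigraph V} (Φ : G.Policy) (μ : PMF V) (π : PMF G.QueueDetail) : Prop :=
  π.bind (fun w => μ.map (Φ w)) = π

/-- The mass `μ(A)`, as a real number. -/
def mass (μ : PMF V) (A : Finset V) : ℝ := ∑ v ∈ A, (μ v).toReal

/-- The set `{x_1, …, x_i}` of the first letters of a word. -/
def firsts {n : ℕ} (x : Fin n → V) (i : Fin n) : Finset V := (Finset.Iic i).image x

variable [Fintype V]

/-- The neighbourhood `ℰ(U)`. -/
def nbhd (G : Multigraph V) (U : Finset V) : Finset V := {v | ∃ u ∈ U, G.Adj u v}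

/-- The set `V₂` of the nodes without self-loop. -/
def loopless (G : Multigraph V) : Finset V := {v | ¬ G.Adj v v}

/-- The (nonempty) independent sets of the multigraph `G`. -/
def indepSets (G : Multigraph V) : Finset (Finset V) :=
  {I | I.Nonempty ∧ ∀ u ∈ I, ∀ v ∈ I, ¬ G.Adj u v}

/-- The (nonempty) independent sets of the maximal subgraph of `G`. -/
def maxSubgraphIndepSets (G : Multigraph V) : Finset (Finset V) :=
  {I | I.Nonempty ∧ G.maxSubgraph.IsIndepSet (I : Set V)}

/-- The set `Ncond(G)`. -/
def Ncond (G : Multigraph V) : Set (PMF V) :=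
  {μ | μ ∈ exactSupport V ∧ ∀ I ∈ G.indepSets, mass μ I < mass μ (G.nbhd I)}

/-- An enumeration `e_1, …, e_{|I|}` of the finite set `I`. -/
def enum (I : Finset V) (i : Fin #I) : V := I.equivFin.symm i

/-- The normalising constant `α`. -/
def normConst (G : Multigraph V) (μ : PMF V) : ℝ :=
  (1 + ∑ I ∈ G.maxSubgraphIndepSets, ∑ σ : Equiv.Perm (Fin #I), ∏ i : Fin #I,
    (μ (enum I (σ i))).toReal /
      (mass μ (G.nbhd (firsts (fun j => enum I (σ j)) i)) -
        mass μ (firsts (fun j => enum I (σ j)) i ∩ G.loopless)))⁻¹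

/-- The product `∏_l μ(w_l) / μ(ℰ({w_1, …, w_l}))`. -/
def wordWeight (G : Multigraph V) (μ : PMF V) (w : List V) : ℝ :=
  ∏ l : Fin w.length, (μ (w.get l)).toReal / mass μ (G.nbhd (firsts w.get l))

end Multigraph

end

/-!
*Sufficiency.* Give the word `w` the weight `∏ μ(w_l) / μ(ℰ({w_1, …, w_l}))`. Under FCFM a queue
detail `w` is reached either from `w` without its last letter, by storing that letter, or from `w`
with one more letter `u`, inserted behind a prefix `p`, by an arrival that is compatible with `u`
but with no letter of `p`. For fixed `u` the second contributions telescope over the prefixes of `w`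
to `μ(u)` times the weight of `w` if no letter of `w` is compatible with `u`; together with the
first one they add up to at most the weight of `w`. So one step of the chain does not increase the
weight, and since it preserves a finite total mass, the weight is invariant. The total mass is found
by cutting a word at the first occurrences of its letters `e_1, e_2, …`: the repetitions between the
`i`-th and the next one contribute a geometric series of ratio
`μ({e_1, …, e_i} ∩ V₂) / μ(ℰ({e_1, …, e_i}))`, which turns the denominators of the word weight into
those of `α⁻¹`, and the condition of `Ncond` is what makes these series converge.

*Necessity.* If `μ(ℰ(I)) ≤ μ(I)` for an independent set `I`, the number of letters in `I` minus that
in `ℰ(I)`, truncated at `0`, is subharmonic, and it grows by at most one per step. Starting from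
the empty buffer, its expectation until the return is therefore bounded away from `0` and at most
`n` times the probability of no return before time `n`, whose sum over `n` then diverges.
-/

noncomputable section

open scoped Classical

theorem eq_of_le_of_tsum_le {X : Type*} {f g : X → ℝ≥0∞} (hfg : f ≤ g) (hf : ∑' x, f x ≠ ∞)
    (hsum : ∑' x, g x ≤ ∑' x, f x) : f = g :=
  hfg.eq_of_not_lt fun hlt =>
    have ⟨_, hx⟩ := (Pi.lt_def.1 hlt).2
    hsum.not_gt (ENNReal.tsum_lt_tsum hf hfg hx)

theorem tsum_inv_natCast_add_eq_top (m : ℕ) : ∑' n : ℕ, ((n + m : ℕ) : ℝ≥0∞)⁻¹ = ∞ := by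
  by_contra hne
  refine Real.not_summable_natCast_inv ((summable_nat_add_iff m).1 ?_)
  simpa only [ENNReal.toReal_inv, ENNReal.toReal_natCast] using ENNReal.summable_toReal hne

/-- A Markov chain on `X`, given by its transition kernel: `P x y` is the probability of a step
from `x` to `y`. -/
abbrev MarkovChain (X : Type*) := X → PMF X

namespace MarkovChain

variable {X : Type*} (P : MarkovChain X)

/-- The measure `f P` on `X`: the distribution after one step of a chain distributed as `f`. -/
def push (f : X → ℝ≥0∞) (y : X) : ℝ≥0∞ := ∑' x, f x * P x y

/-- The function `P h` on `X`: the expectation of `h` after one step of the chain. -/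
def mean (h : X → ℝ≥0∞) (x : X) : ℝ≥0∞ := ∑' y, P x y * h y

/-- The measure `f` is invariant under the chain. -/
def Invariant (f : X → ℝ≥0∞) : Prop := P.push f = f

theorem tsum_push_mul (f h : X → ℝ≥0∞) : ∑' y, P.push f y * h y = ∑' x, f x * P.mean h x := by
  simp only [push, mean, ← ENNReal.tsum_mul_right, ← ENNReal.tsum_mul_left, mul_assoc]
  exact ENNReal.tsum_comm

theorem mean_one (x : X) : P.mean (fun _ => 1) x = 1 := by
  simp only [mean, mul_one, (P x).tsum_coe]

theorem tsum_push (f : X → ℝ≥0∞) : ∑' y, P.push f y = ∑' x, f x := by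
  simpa only [mean_one, mul_one] using P.tsum_push_mul f fun _ => 1

theorem push_mono {f g : X → ℝ≥0∞} (hfg : f ≤ g) : P.push f ≤ P.push g :=
  fun _ => ENNReal.tsum_le_tsum fun x => mul_le_mul_left (hfg x) _

theorem push_add (f g : X → ℝ≥0∞) : P.push (f + g) = P.push f + P.push g :=
  funext fun _ => by simp only [push, Pi.add_apply, add_mul, ENNReal.tsum_add]

theorem mean_mono {f g : X → ℝ≥0∞} (x : X) (hfg : ∀ y, P x y ≠ 0 → f y ≤ g y) :
    P.mean f x ≤ P.mean g x := by
  refine ENNReal.tsum_le_tsum fun y => ?_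
  by_cases hy : P x y = 0
  · simp only [hy, zero_mul, le_refl]
  · exact mul_le_mul_right (hfg y hy) _

theorem mean_const_mul (c : ℝ≥0∞) (h : X → ℝ≥0∞) (x : X) :
    P.mean (fun y => c * h y) x = c * P.mean h x := by
  simp only [mean, ← ENNReal.tsum_mul_left, mul_left_comm]

section Invariant

variable {P} {f g : X → ℝ≥0∞}

theorem invariant_of_push_le (hf : ∑' x, f x ≠ ∞) (hle : P.push f ≤ f) : P.Invariant f :=
  eq_of_le_of_tsum_le hle (by rwa [tsum_push]) (by rw [tsum_push])

theorem Invariant.inf (hf : P.Invariant f) (hg : P.Invariant g) (hsum : ∑' x, f x ≠ ∞) :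
    P.Invariant (f ⊓ g) :=
  invariant_of_push_le (ne_top_of_le_ne_top hsum (ENNReal.tsum_le_tsum fun _ => inf_le_left))
    (le_inf ((P.push_mono inf_le_left).trans hf.le) ((P.push_mono inf_le_right).trans hg.le))

theorem Invariant.sub (hf : P.Invariant f) (hg : P.Invariant g) (hgf : g ≤ f)
    (hsum : ∑' x, g x ≠ ∞) : P.Invariant (f - g) := by
  have hadd : P.push (f - g) + g = f := by
    nth_rw 2 [← hg]
    rw [← push_add, tsub_add_cancel_of_le hgf, hf]
  funext x
  exact ENNReal.eq_sub_of_add_eq (ENNReal.ne_top_of_tsum_ne_top hsum x) (congrFun hadd x)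

theorem Invariant.ne_zero_of_reachable (hf : P.Invariant f) {x y : X} (hx : f x ≠ 0)
    (hxy : Relation.ReflTransGen (fun x y => P x y ≠ 0) x y) : f y ≠ 0 := by
  induction hxy with
  | refl => exact hx
  | @tail y z _ hstep hy =>
    rw [← hf]
    exact fun hz => mul_ne_zero hy hstep (ENNReal.tsum_eq_zero.1 hz y)

/-- Subtract from one of two invariant probabilities their minimum: if it is the one that is smaller
at the state reachable from everywhere, what remains is invariant and vanishes there. -/
theorem Invariant.unique {e : X} (hreach : ∀ x, Relation.ReflTransGen (fun x y => P x y ≠ 0) x e)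
    {π π' : PMF X} (hπ : P.Invariant π) (hπ' : P.Invariant π') : π = π' := by
  wlog hle : π e ≤ π' e generalizing π π'
  · exact (this hπ' hπ (le_of_not_ge hle)).symm
  have hsum : ∑' x, (⇑π ⊓ ⇑π') x ≠ ∞ :=
    ne_top_of_le_ne_top π.tsum_coe_ne_top (ENNReal.tsum_le_tsum fun _ => inf_le_left)
  have hinv : P.Invariant (⇑π - ⇑π ⊓ ⇑π') :=
    hπ.sub (hπ.inf hπ' π.tsum_coe_ne_top) inf_le_left hsum
  have hle' : ∀ x, π x ≤ π' x := fun x => by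
    by_contra hx
    refine hinv.ne_zero_of_reachable (x := x) ?_ (hreach x) ?_
    · simpa [tsub_eq_zero_iff_le] using hx
    · simp [hle]
  exact DFunLike.coe_injective
    (eq_of_le_of_tsum_le hle' π.tsum_coe_ne_top (by rw [π.tsum_coe, π'.tsum_coe]))

end Invariant

/-- The probability that the chain started from `x` is not in state `w` at any of the times
`1, …, n`. -/
def avoidProb (w : X) : ℕ → X → ℝ≥0∞
  | 0, _ => 1
  | n + 1, x => P.mean (({w}ᶜ : Set X).indicator (avoidProb w n)) x

variable {P}

theorem Invariant.tsum_mul_avoidProb {f : X → ℝ≥0∞} (hf : P.Invariant f) (w : X) (n : ℕ) :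
    ∑' x, f x * P.avoidProb w n x =
      ∑' x, f x * P.avoidProb w (n + 1) x + f w * P.avoidProb w n w := by
  have hstep : ∑' x, f x * P.avoidProb w (n + 1) x =
      ∑' x, f x * ({w}ᶜ : Set X).indicator (P.avoidProb w n) x := by
    simp only [avoidProb]
    rw [← tsum_push_mul, hf]
  rw [hstep, ENNReal.tsum_eq_add_tsum_ite w, add_comm]
  congr 1
  refine tsum_congr fun y => ?_
  by_cases hy : y = w <;> simp [hy]

/-- Half of Kac's formula, since `∑' n, P.avoidProb w n w` is the mean return time to `w`. -/
theorem Invariant.mul_tsum_avoidProb_le {f : X → ℝ≥0∞} (hf : P.Invariant f) (w : X) :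
    f w * ∑' n, P.avoidProb w n w ≤ ∑' x, f x := by
  rw [← ENNReal.tsum_mul_left, ENNReal.tsum_eq_iSup_nat]
  refine iSup_le fun N => ?_
  suffices htel : ∑ n ∈ Finset.range N, f w * P.avoidProb w n w + ∑' x, f x * P.avoidProb w N x =
      ∑' x, f x from htel ▸ le_self_add
  induction N with
  | zero => simp only [Finset.range_zero, Finset.sum_empty, avoidProb, mul_one, zero_add]
  | succ N ih =>
    rw [← ih, hf.tsum_mul_avoidProb w N, Finset.sum_range_succ]
    ring

theorem mean_le_mul_avoidProb {F : X → ℝ≥0∞} {L : X → ℕ} {w : X} (hF : F ≤ P.mean F)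
    (hFw : F w = 0) (hFL : ∀ x, F x ≤ L x) (hL : ∀ x y, P x y ≠ 0 → L y ≤ L x + 1) (n : ℕ) (x : X) :
    P.mean F x ≤ ((n + (L x + 1) : ℕ) : ℝ≥0∞) * P.avoidProb w (n + 1) x := by
  rw [avoidProb, ← mean_const_mul]
  refine P.mean_mono x fun y hxy => ?_
  rcases eq_or_ne y w with rfl | hyw
  · simp only [hFw, zero_le]
  rw [Set.indicator_of_mem hyw]
  cases n with
  | zero =>
    rw [avoidProb, mul_one, zero_add]
    exact (hFL y).trans (Nat.cast_le.2 (hL x y hxy))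
  | succ n =>
    refine (hF y).trans ((mean_le_mul_avoidProb hF hFw hFL hL n y).trans ?_)
    have := hL x y hxy
    exact mul_le_mul_left (Nat.cast_le.2 (by omega)) _

/-- Since `F` grows at most linearly along the chain, the bound above lets `avoidProb w n w` decay
no faster than `1 / n` unless `F` stays at `0`. -/
theorem mean_eq_zero_of_tsum_avoidProb_ne_top {F : X → ℝ≥0∞} {L : X → ℕ} {w : X}
    (hF : F ≤ P.mean F) (hFw : F w = 0) (hFL : ∀ x, F x ≤ L x)
    (hL : ∀ x y, P x y ≠ 0 → L y ≤ L x + 1) (hw : ∑' n, P.avoidProb w n w ≠ ∞) :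
    P.mean F w = 0 := by
  by_contra hne
  refine hw (eq_top_iff.2 ?_)
  calc ∞ = ∑' n : ℕ, P.mean F w * ((n + (L w + 1) : ℕ) : ℝ≥0∞)⁻¹ := by
        rw [ENNReal.tsum_mul_left, tsum_inv_natCast_add_eq_top, ENNReal.mul_top hne]
    _ ≤ ∑' n, P.avoidProb w (n + 1) w := ENNReal.tsum_le_tsum fun n =>
        ENNReal.div_le_of_le_mul' (mean_le_mul_avoidProb hF hFw hFL hL n w)
    _ ≤ ∑' n, P.avoidProb w n w :=
        ENNReal.tsum_comp_le_tsum_of_injective (add_left_injective 1) _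

end MarkovChain

theorem eq_infinitePi_of_range {X : ℕ → Type*} [∀ i, MeasurableSpace (X i)]
    (μ : ∀ i, Measure (X i)) [∀ i, IsProbabilityMeasure (μ i)] {ν : Measure (∀ i, X i)}
    (hν : ∀ n (t : ∀ i, Set (X i)), (∀ i, MeasurableSet (t i)) →
      ν (Set.pi (Finset.range n) t) = ∏ i ∈ Finset.range n, μ i (t i)) :
    ν = Measure.infinitePi μ := by
  refine Measure.eq_infinitePi μ fun s t ht => ?_
  have hs : s ⊆ Finset.range (s.sup id + 1) := Finset.subset_range_sup_succ s
  have h := hν (s.sup id + 1) (fun i => if i ∈ s then t i else Set.univ) fun i => by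
    split_ifs
    exacts [ht i, MeasurableSet.univ]
  rw [← Finset.prod_subset hs fun i _ hi => by simp [hi]] at h
  rw [← Finset.prod_congr rfl fun i hi => congrArg (μ i) (if_pos hi), ← h]
  congr 1
  ext a
  simp only [Set.mem_pi, Finset.mem_coe]
  exact ⟨fun ha i _ => by split_ifs with hi; exacts [ha i hi, trivial],
    fun ha i hi => by simpa [hi] using ha i (hs hi)⟩

namespace Multigraph

variable {V : Type*} {G : Multigraph V}

/-- The chain of the buffer contents under the policy `Φ`, for arrivals of law `μ`. -/
def chain (Φ : G.Policy) (μ : PMF V) : MarkovChain G.QueueDetail := fun w => μ.map (Φ w)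

theorem isStationary_iff_invariant {Φ : G.Policy} {μ : PMF V} {π : PMF G.QueueDetail} :
    IsStationary Φ μ π ↔ (chain Φ μ).Invariant π :=
  ⟨fun h => funext fun w => (PMF.bind_apply π _ w).symm.trans (DFunLike.congr_fun h w),
    fun h => PMF.ext fun w => (PMF.bind_apply π _ w).trans (congrFun h w)⟩

theorem mean_chain (Φ : G.Policy) (μ : PMF V) (h : G.QueueDetail → ℝ≥0∞) (w : G.QueueDetail) :
    (chain Φ μ).mean h w = ∑' v, μ v * h (Φ w v) := by
  simp only [MarkovChain.mean, chain, PMF.map_apply, ← ENNReal.tsum_mul_right, ite_mul, zero_mul]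
  rw [ENNReal.tsum_comm]
  exact tsum_congr fun v => by rw [tsum_ite_eq]

theorem chain_ne_zero_iff {Φ : G.Policy} {μ : PMF V} {x y : G.QueueDetail} :
    chain Φ μ x y ≠ 0 ↔ ∃ v, μ v ≠ 0 ∧ Φ x v = y := by
  rw [chain, ← PMF.mem_support_iff, PMF.mem_support_map_iff]
  rfl

/-- The sequence with first term `v`, followed by the sequence `a`. -/
def consSeq (v : V) (a : ℕ → V) : ℕ → V
  | 0 => v
  | n + 1 => a n

theorem buffer_consSeq (Φ : G.Policy) (x : G.QueueDetail) (v : V) (a : ℕ → V) (n : ℕ) :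
    buffer Φ x (consSeq v a) (n + 1) = buffer Φ (Φ x v) a n := by
  induction n with
  | zero => rfl
  | succ n ih => rw [buffer, ih]; rfl

/-- The buffer content started from `x` is not `w` at any of the times `1, …, n`. -/
def Avoids (Φ : G.Policy) (w x : G.QueueDetail) (n : ℕ) (a : ℕ → V) : Prop :=
  ∀ k < n, buffer Φ x a (k + 1) ≠ w

theorem avoids_consSeq_succ (Φ : G.Policy) (w x : G.QueueDetail) (n : ℕ) (v : V) (a : ℕ → V) :
    Avoids Φ w x (n + 1) (consSeq v a) ↔ Φ x v ≠ w ∧ Avoids Φ w (Φ x v) n a := by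
  simp only [Avoids, buffer_consSeq, Nat.forall_lt_succ_left']
  rfl

theorem returnTime_eq_tsum (Φ : G.Policy) (w : G.QueueDetail) (a : ℕ → V) :
    returnTime Φ w a = ∑' n : ℕ, {a | Avoids Φ w w n a}.indicator 1 a := by
  simp only [Set.indicator_apply, Set.mem_ofPred_eq, Pi.one_apply]
  by_cases h : ∃ k, buffer Φ w a (k + 1) = w
  · have havoids (n : ℕ) : Avoids Φ w w n a ↔ n ∈ Finset.range (Nat.find h + 1) := by
      rw [Finset.mem_range, Nat.lt_succ_iff, Nat.le_find_iff]
      rfl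
    have htime : returnTime Φ w a = (Nat.find h + 1 : ℕ) := by
      refine le_antisymm (iInf₂_le _ ⟨Nat.le_add_left .., Nat.find_spec h⟩)
        (le_iInf₂ fun n hn => ?_)
      obtain ⟨k, rfl⟩ := Nat.exists_eq_add_of_le' hn.1
      exact Nat.cast_le.2 (Nat.succ_le_succ (Nat.find_min' h hn.2))
    simp only [havoids]
    rw [htime, tsum_eq_sum fun n hn => if_neg hn, Finset.sum_ite_mem, Finset.inter_self]
    simp
  · push Not at h
    have havoids (n : ℕ) : Avoids Φ w w n a := fun k _ => h k
    have htime : returnTime Φ w a = ∞ := iInf₂_eq_top.2 fun n hn => by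
      obtain ⟨k, rfl⟩ := Nat.exists_eq_add_of_le' hn.1
      exact absurd hn.2 (h k)
    simp only [havoids, if_true, htime, ENNReal.tsum_const_eq_top_of_ne_zero one_ne_zero]

theorem preimage_consSeq_pi_range (n : ℕ) (t : ℕ → Set V) :
    (fun p : V × (ℕ → V) => consSeq p.1 p.2) ⁻¹' Set.pi (Finset.range (n + 1)) t =
      t 0 ×ˢ Set.pi (Finset.range n) fun i => t (i + 1) := by
  ext
  simp only [Set.mem_preimage, Set.mem_pi, Finset.mem_coe, Finset.mem_range,
    Nat.forall_lt_succ_left', Set.mem_prod, consSeq]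

section ArrivalSequence

variable [MeasurableSpace V]

instance (μ : PMF V) : IsProbabilityMeasure (arrivals μ) :=
  inferInstanceAs (IsProbabilityMeasure (Measure.infinitePi _))

theorem measurable_consSeq : Measurable fun p : V × (ℕ → V) => consSeq p.1 p.2 := by
  refine measurable_pi_lambda _ fun n => ?_
  cases n with
  | zero => exact measurable_fst
  | succ n => exact (measurable_pi_apply n).comp measurable_snd

theorem map_consSeq_arrivals (μ : PMF V) :
    (μ.toMeasure.prod (arrivals μ)).map (fun p => consSeq p.1 p.2) = arrivals μ := by
  refine eq_infinitePi_of_range _ fun n t ht => ?_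
  rw [Measure.map_apply measurable_consSeq (.pi (Finset.countable_toSet _) fun i _ => ht i)]
  cases n with
  | zero => simp
  | succ n =>
    rw [preimage_consSeq_pi_range, Measure.prod_prod, arrivals,
      Measure.infinitePi_pi _ fun i _ => ht (i + 1), Finset.prod_range_succ', mul_comm]

variable [Countable V] [MeasurableSingletonClass V]

theorem lintegral_arrivals (μ : PMF V) {F : (ℕ → V) → ℝ≥0∞} (hF : Measurable F) :
    ∫⁻ a, F a ∂(arrivals μ) = ∑' v, μ v * ∫⁻ a, F (consSeq v a) ∂(arrivals μ) := by
  conv_lhs => rw [← map_consSeq_arrivals μ]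
  rw [lintegral_map hF measurable_consSeq,
    lintegral_prod (fun p => F (consSeq p.1 p.2)) (hF.comp measurable_consSeq).aemeasurable,
    lintegral_countable']
  refine tsum_congr fun v => ?_
  rw [PMF.toMeasure_apply_singleton _ _ (measurableSet_singleton v), mul_comm]

theorem measurableSet_buffer_eq (Φ : G.Policy) (x w : G.QueueDetail) (n : ℕ) :
    MeasurableSet {a : ℕ → V | buffer Φ x a n = w} := by
  let : MeasurableSpace G.QueueDetail := ⊤
  suffices hbuffer : Measurable fun a : ℕ → V => buffer Φ x a n from
    hbuffer (measurableSet_singleton w)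
  induction n with
  | zero => exact measurable_const
  | succ n ih =>
    exact (Measurable.of_discrete (f := fun p : G.QueueDetail × V => Φ p.1 p.2)).comp
      (ih.prodMk (measurable_pi_apply n))

theorem measurableSet_avoids (Φ : G.Policy) (w x : G.QueueDetail) (n : ℕ) :
    MeasurableSet {a : ℕ → V | Avoids Φ w x n a} := by
  simp only [Avoids, Set.ofPred_forall]
  exact .iInter fun k => .iInter fun _ => (measurableSet_buffer_eq Φ x w (k + 1)).compl

theorem arrivals_avoids (Φ : G.Policy) (μ : PMF V) (w : G.QueueDetail) (n : ℕ)
    (x : G.QueueDetail) :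
    arrivals μ {a | Avoids Φ w x n a} = (chain Φ μ).avoidProb w n x := by
  induction n generalizing x with
  | zero => simp [Avoids, MarkovChain.avoidProb]
  | succ n ih =>
    rw [← lintegral_indicator_one (measurableSet_avoids Φ w x (n + 1)),
      lintegral_arrivals μ (measurable_one.indicator (measurableSet_avoids Φ w x (n + 1))),
      MarkovChain.avoidProb, mean_chain]
    refine tsum_congr fun v => congrArg _ ?_
    rcases eq_or_ne (Φ x v) w with hv | hv
    · simp [avoids_consSeq_succ, hv]
    · rw [Set.indicator_of_mem hv, ← ih, ← lintegral_indicator_one (measurableSet_avoids ..)]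
      simp [Set.indicator_apply, avoids_consSeq_succ, hv]

theorem lintegral_returnTime (Φ : G.Policy) (μ : PMF V) (w : G.QueueDetail) :
    ∫⁻ a, returnTime Φ w a ∂(arrivals μ) = ∑' n, (chain Φ μ).avoidProb w n w := by
  simp only [returnTime_eq_tsum]
  rw [lintegral_tsum fun n =>
    (measurable_one.indicator (measurableSet_avoids Φ w w n)).aemeasurable]
  simp only [lintegral_indicator_one (measurableSet_avoids Φ w w _), arrivals_avoids]

theorem IsStationary.positiveRecurrent {Φ : G.Policy} {μ : PMF V} {π : PMF G.QueueDetail}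
    (hπ : IsStationary Φ μ π) (hpos : ∀ w, π w ≠ 0) : PositiveRecurrent Φ μ := by
  intro w
  have hle := (isStationary_iff_invariant.1 hπ).mul_tsum_avoidProb_le w
  rw [π.tsum_coe] at hle
  rw [lintegral_returnTime, lt_top_iff_ne_top]
  exact fun htop => by simp [htop, ENNReal.mul_top (hpos w)] at hle

end ArrivalSequence

/-- The mass `μ(A)`, as an extended nonnegative real number. -/
def prob (μ : PMF V) (A : Finset V) : ℝ≥0∞ := ∑ v ∈ A, μ v

theorem prob_ne_top (μ : PMF V) (A : Finset V) : prob μ A ≠ ∞ :=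
  ENNReal.sum_ne_top.2 fun v _ => μ.apply_ne_top v

theorem toReal_prob (μ : PMF V) (A : Finset V) : (prob μ A).toReal = mass μ A :=
  ENNReal.toReal_sum fun v _ => μ.apply_ne_top v

theorem mass_lt_mass_iff {μ : PMF V} {A B : Finset V} :
    mass μ A < mass μ B ↔ prob μ A < prob μ B := by
  rw [← toReal_prob, ← toReal_prob, ENNReal.toReal_lt_toReal (prob_ne_top μ A) (prob_ne_top μ B)]

theorem mem_exactSupport_iff {μ : PMF V} : μ ∈ exactSupport V ↔ ∀ v, μ v ≠ 0 := by
  simp only [exactSupport, Set.mem_ofPred_eq, Set.eq_univ_iff_forall, PMF.mem_support_iff]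

/-- The empty buffer content. -/
def emptyDetail (G : Multigraph V) : G.QueueDetail := ⟨[], by simp [IsQueueDetail]⟩

theorem length_fcfmWord_le (w : List V) (v : V) : (G.fcfmWord w v).length ≤ w.length + 1 := by
  unfold fcfmWord
  split_ifs
  · exact List.eraseP_sublist.length_le.trans (Nat.le_succ _)
  · exact List.length_append.le

theorem reachable_emptyDetail {μ : PMF V} (hμ : ∀ v, μ v ≠ 0) (hadj : ∀ v, ∃ u, G.Adj v u)
    (x : G.QueueDetail) :
    Relation.ReflTransGen (fun x y => chain G.fcfm μ x y ≠ 0) x G.emptyDetail := by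
  obtain ⟨w, hw⟩ := x
  induction w with
  | nil => exact .refl
  | cons y w ih =>
    obtain ⟨u, hyu⟩ := hadj y
    have hstep : G.fcfmWord (y :: w) u = w := by simp [fcfmWord, hyu]
    have hw' : G.IsQueueDetail w := hstep ▸ hw.fcfmWord u
    exact .head (chain_ne_zero_iff.2 ⟨u, hμ u, Subtype.ext (a2 := ⟨w, hw'⟩) hstep⟩) (ih hw')

theorem fcfmWord_cases (w : List V) (v : V) :
    (∃ l₁ a l₂, w = l₁ ++ a :: l₂ ∧ G.fcfmWord w v = l₁ ++ l₂ ∧ G.Adj a v ∧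
      ∀ u ∈ l₁, ¬ G.Adj u v) ∨
    G.fcfmWord w v = w ++ [v] := by
  by_cases h : ∃ u ∈ w, G.Adj u v
  · obtain ⟨u, hu, huv⟩ := h
    obtain ⟨a, l₁, l₂, hl₁, hav, hw, herase⟩ :=
      List.exists_of_eraseP (p := fun u => decide (G.Adj u v)) hu (decide_eq_true huv)
    exact .inl ⟨l₁, a, l₂, hw, by rw [fcfmWord, if_pos ⟨u, hu, huv⟩, herase], of_decide_eq_true hav,
      fun b hb hbv => hl₁ b hb (decide_eq_true hbv)⟩
  · exact .inr (if_neg h)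

/-- The excess of the number of letters of `w` in `I` over the number of those in `J`, truncated at
`0`. -/
def surplus (I J : Finset V) (w : List V) : ℝ≥0∞ :=
  (w.countP (· ∈ I) - w.countP (· ∈ J) : ℕ)

section Necessity

theorem tsum_mul_countP_singleton (μ : PMF V) (A : Finset V) :
    ∑' v, μ v * ([v].countP (· ∈ A) : ℕ) = prob μ A := by
  rw [prob, tsum_eq_sum (s := A) fun v hv => by simp [hv]]
  exact Finset.sum_congr rfl fun v hv => by simp [hv]

variable [Fintype V]

theorem mem_nbhd {U : Finset V} {v : V} : v ∈ G.nbhd U ↔ ∃ u ∈ U, G.Adj u v := by simp [nbhd]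

theorem countP_add_countP_le (I : Finset V) (w : List V) (v : V) :
    w.countP (· ∈ I) + [v].countP (· ∈ I) + (G.fcfmWord w v).countP (· ∈ G.nbhd I) ≤
      w.countP (· ∈ G.nbhd I) + [v].countP (· ∈ G.nbhd I) +
        (G.fcfmWord w v).countP (· ∈ I) := by
  rcases G.fcfmWord_cases w v with ⟨l₁, a, l₂, rfl, hmatch, hav, -⟩ | hstore
  · have haI : a ∈ I → v ∈ G.nbhd I := fun ha => mem_nbhd.2 ⟨a, ha, hav⟩
    have hvI : v ∈ I → a ∈ G.nbhd I := fun hv => mem_nbhd.2 ⟨v, hv, G.symm _ _ hav⟩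
    rw [hmatch]
    simp only [List.countP_append, List.countP_cons, List.countP_nil, decide_eq_true_eq]
    split_ifs <;> first | omega | simp_all
  · rw [hstore, List.countP_append, List.countP_append]
    omega

theorem surplus_le_mean {μ : PMF V} {I : Finset V} (hI : prob μ (G.nbhd I) ≤ prob μ I)
    (w : G.QueueDetail) :
    surplus I (G.nbhd I) w.1 ≤ (chain G.fcfm μ).mean (fun x => surplus I (G.nbhd I) x.1) w := by
  set m := (chain G.fcfm μ).mean (fun x => surplus I (G.nbhd I) x.1) w with hm
  have hstep (v : V) : (w.1.countP (· ∈ I) + [v].countP (· ∈ I) : ℝ≥0∞) ≤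
      w.1.countP (· ∈ G.nbhd I) + [v].countP (· ∈ G.nbhd I) +
        surplus I (G.nbhd I) (G.fcfmWord w.1 v) := by
    have := G.countP_add_countP_le I w.1 v
    rw [surplus]
    exact_mod_cast (by omega)
  have hmean : (w.1.countP (· ∈ I) : ℝ≥0∞) + prob μ I ≤
      w.1.countP (· ∈ G.nbhd I) + prob μ (G.nbhd I) + m := by
    have := ENNReal.tsum_le_tsum fun v => mul_le_mul_right (hstep v) (μ v)
    simpa only [mul_add, ENNReal.tsum_add, ENNReal.tsum_mul_right, μ.tsum_coe, one_mul,
      tsum_mul_countP_singleton, hm, mean_chain, fcfm] using this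
  have hcancel : (w.1.countP (· ∈ I) : ℝ≥0∞) ≤ w.1.countP (· ∈ G.nbhd I) + m := by
    refine ENNReal.le_of_add_le_add_right (prob_ne_top μ I) (hmean.trans ?_)
    rw [add_right_comm]
    gcongr
  rwa [surplus, ENNReal.natCast_sub, tsub_le_iff_left]

variable [MeasurableSpace V] [MeasurableSingletonClass V]

theorem mass_lt_of_positiveRecurrent {μ : PMF V} (hμ : ∀ v, μ v ≠ 0)
    (hrec : PositiveRecurrent G.fcfm μ) {I : Finset V} (hI : I ∈ G.indepSets) :
    mass μ I < mass μ (G.nbhd I) := by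
  obtain ⟨⟨v, hv⟩, hindep⟩ := (Finset.mem_filter.1 hI).2
  by_contra hle
  rw [mass_lt_mass_iff, not_lt] at hle
  have hreturn := (hrec G.emptyDetail).ne
  rw [lintegral_returnTime] at hreturn
  have hmean := MarkovChain.mean_eq_zero_of_tsum_avoidProb_ne_top (L := fun x => x.1.length)
    (surplus_le_mean hle) (by simp [surplus, emptyDetail])
    (fun x => Nat.cast_le.2 ((Nat.sub_le _ _).trans List.countP_le_length))
    (fun x y hxy => by
      obtain ⟨u, -, rfl⟩ := chain_ne_zero_iff.1 hxy
      exact length_fcfmWord_le x.1 u) hreturn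
  rw [mean_chain, ENNReal.tsum_eq_zero] at hmean
  have hvJ : v ∉ G.nbhd I := fun hvJ =>
    have ⟨u, hu, huv⟩ := mem_nbhd.1 hvJ
    hindep u hu v hv huv
  have hone : surplus I (G.nbhd I) (G.fcfm G.emptyDetail v).1 = 1 := by
    simp [surplus, fcfm, fcfmWord, emptyDetail, hv, hvJ]
  exact mul_ne_zero (hμ v) (hone ▸ one_ne_zero) (hmean v)

end Necessity

section ListWeight

variable {M : Type*} [CommMonoid M]

/-- The product over the letters `x` of a word of the weights `c S x`, where `S` consists of an
initial set and of the letters that precede `x`. -/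
def listWeight (c : Finset V → V → M) : Finset V → List V → M
  | _, [] => 1
  | S, x :: l => c S x * listWeight c (insert x S) l

theorem listWeight_cons (c : Finset V → V → M) (S : Finset V) (x : V) (l : List V) :
    listWeight c S (x :: l) = c S x * listWeight c (insert x S) l := rfl

theorem listWeight_append (c : Finset V → V → M) (S : Finset V) (l l' : List V) :
    listWeight c S (l ++ l') = listWeight c S l * listWeight c (S ∪ l.toFinset) l' := by
  induction l generalizing S with
  | nil => simp [listWeight]
  | cons x l ih =>
    rw [List.cons_append, listWeight_cons, ih, listWeight_cons, mul_assoc, List.toFinset_cons,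
      Finset.insert_union, Finset.union_insert]

theorem listWeight_ofFn (c : Finset V → V → M) {n : ℕ} (S : Finset V) (x : Fin n → V) :
    listWeight c S (List.ofFn x) = ∏ i, c (S ∪ (Finset.Iio i).image x) (x i) := by
  induction n generalizing S with
  | zero => simp [listWeight]
  | succ n ih =>
    have himage (i : Fin n) : (Finset.Iio i.succ).image x =
        insert (x 0) ((Finset.Iio i).image fun j => x j.succ) := by
      ext y
      simp [Fin.exists_fin_succ, eq_comm]
    have hzero : (Finset.Iio (0 : Fin (n + 1))).image x = ∅ := rfl
    simp only [List.ofFn_succ, listWeight, ih, Fin.prod_univ_succ, himage, hzero,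
      Finset.union_empty, Finset.insert_union, Finset.union_insert]

end ListWeight

theorem insert_image_Iio {n : ℕ} (x : Fin n → V) (i : Fin n) :
    insert (x i) ((Finset.Iio i).image x) = firsts x i := by
  rw [firsts, ← Finset.image_insert, Finset.Iio_insert]

theorem prob_mono (μ : PMF V) {A B : Finset V} (hAB : A ⊆ B) : prob μ A ≤ prob μ B :=
  Finset.sum_le_sum_of_subset hAB

section ProductForm

variable [Fintype V]

/-- The set of the classes that are compatible with `u` but with no class of `S`: under FCFM, these
are the classes that are matched with a `u`-item preceded by the classes of `S`. -/
def freshNbhd (G : Multigraph V) (S : Finset V) (u : V) : Finset V :=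
  G.nbhd (insert u S) \ G.nbhd S

/-- The factor `μ(x) / μ(ℰ(S ∪ {x}))` of a letter `x` that is preceded by the letters of `S` in the
product-form weight of a word. -/
def letterWeight (G : Multigraph V) (μ : PMF V) (S : Finset V) (x : V) : ℝ≥0∞ :=
  μ x / prob μ (G.nbhd (insert x S))

theorem prob_add_prob_compl (μ : PMF V) (A : Finset V) : prob μ A + prob μ Aᶜ = 1 := by
  rw [prob, prob, Finset.sum_add_sum_compl, ← μ.tsum_coe, tsum_fintype]

theorem nbhd_mono {S T : Finset V} (hST : S ⊆ T) : G.nbhd S ⊆ G.nbhd T := fun _ hv =>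
  have ⟨u, hu, huv⟩ := mem_nbhd.1 hv
  mem_nbhd.2 ⟨u, hST hu, huv⟩

theorem prob_nbhd_empty (μ : PMF V) : prob μ (G.nbhd ∅) = 0 := by simp [prob, nbhd]

theorem toReal_listWeight_letterWeight (μ : PMF V) (w : List V) :
    (listWeight (G.letterWeight μ) ∅ w).toReal = G.wordWeight μ w := by
  conv_lhs => rw [← List.ofFn_get w]
  simp only [listWeight_ofFn, Finset.empty_union, letterWeight, insert_image_Iio,
    ENNReal.toReal_prod, ENNReal.toReal_div, toReal_prob, wordWeight]

variable {μ : PMF V}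

theorem mul_letterWeight_insert_comm (S : Finset V) (u y : V) :
    μ u * G.letterWeight μ (insert u S) y = μ y * G.letterWeight μ (insert y S) u := by
  simp only [letterWeight, Finset.insert_comm, div_eq_mul_inv, mul_left_comm]

theorem IsQueueDetail.notMem_nbhd {l₁ l₂ : List V} {u : V}
    (h : G.IsQueueDetail (l₁ ++ u :: l₂)) : u ∉ G.nbhd (l₁ ++ l₂).toFinset := by
  rw [mem_nbhd]
  rintro ⟨y, hy, hyu⟩
  have hpos : 0 < (l₁ ++ l₂).count y := List.count_pos_iff.2 (List.mem_toFinset.1 hy)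
  obtain rfl | hne := eq_or_ne y u
  · have hloop := h.2 y hyu
    simp only [List.count_append, List.count_cons_self] at hloop hpos
    omega
  · have hedge := h.1 y u hne hyu
    simp only [List.count_append, List.count_cons_self, List.count_cons_of_ne hne.symm]
      at hedge hpos
    rcases Nat.mul_eq_zero.1 hedge with hzero | hzero <;> omega

theorem fcfm_eq_cases {x w : G.QueueDetail} {v : V} (h : G.fcfm x v = w) :
    x.1 ++ [v] = w.1 ∨ ∃ u ∈ (G.nbhd w.1.toFinset)ᶜ, ∃ k ∈ Finset.range (w.1.length + 1),
      x.1 = w.1.take k ++ u :: w.1.drop k ∧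
      v ∈ G.freshNbhd (w.1.take k).toFinset u := by
  have hw : G.fcfmWord x.1 v = w.1 := congrArg Subtype.val h
  rcases G.fcfmWord_cases x.1 v with ⟨l₁, u, l₂, hx, hmatch, huv, hl₁⟩ | hstore
  · rw [hmatch] at hw
    refine .inr ⟨u, ?_, l₁.length, ?_, ?_, ?_⟩
    · rw [Finset.mem_compl, ← hw]
      exact (hx ▸ x.2).notMem_nbhd
    · simp [← hw]
    · simp [← hw, hx]
    · rw [← hw, List.take_left, freshNbhd, Finset.mem_sdiff, mem_nbhd, mem_nbhd]
      exact ⟨⟨u, Finset.mem_insert_self _ _, huv⟩,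
        fun ⟨y, hy, hyv⟩ => hl₁ y (List.mem_toFinset.1 hy) hyv⟩
  · exact .inl (hstore.symm.trans hw)

theorem ite_fcfm_eq_le (f : V → ℝ≥0∞) (x w : G.QueueDetail) (v : V) :
    (if G.fcfm x v = w then f v else 0) ≤ (if x.1 ++ [v] = w.1 then f v else 0) +
      ∑ u ∈ (G.nbhd w.1.toFinset)ᶜ, ∑ k ∈ Finset.range (w.1.length + 1),
        if x.1 = w.1.take k ++ u :: w.1.drop k then
          if v ∈ G.freshNbhd (w.1.take k).toFinset u then f v else 0
        else 0 := by
  split_ifs with hxv happ happ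
  · exact le_self_add
  · obtain ⟨u, hu, k, hk, hx, hv⟩ := (fcfm_eq_cases hxv).resolve_left happ
    rw [zero_add]
    refine le_trans ?_ (Finset.single_le_sum (fun _ _ => zero_le) hu)
    refine le_trans ?_ (Finset.single_le_sum (fun _ _ => zero_le) hk)
    rw [if_pos hx, if_pos hv]
  all_goals exact zero_le

theorem push_chain_fcfm_le (f : List V → ℝ≥0∞) (w : G.QueueDetail) :
    (chain G.fcfm μ).push (fun x => f x.1) w ≤
      ∑' l, ∑' v, (if l ++ [v] = w.1 then f l * μ v else 0) +
      ∑ u ∈ (G.nbhd w.1.toFinset)ᶜ, ∑ k ∈ Finset.range (w.1.length + 1),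
        f (w.1.take k ++ u :: w.1.drop k) * prob μ (G.freshNbhd (w.1.take k).toFinset u) := by
  calc (chain G.fcfm μ).push (fun x => f x.1) w
      = ∑' x : G.QueueDetail, ∑' v, if G.fcfm x v = w then f x.1 * μ v else 0 := by
        simp only [MarkovChain.push, chain, PMF.map_apply, ← ENNReal.tsum_mul_left, mul_ite,
          mul_zero, eq_comm]
    _ ≤ ∑' x : G.QueueDetail, ∑' v, ((if x.1 ++ [v] = w.1 then f x.1 * μ v else 0) +
          ∑ u ∈ (G.nbhd w.1.toFinset)ᶜ, ∑ k ∈ Finset.range (w.1.length + 1),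
            if x.1 = w.1.take k ++ u :: w.1.drop k then
              if v ∈ G.freshNbhd (w.1.take k).toFinset u then f x.1 * μ v else 0
            else 0) :=
        ENNReal.tsum_le_tsum fun x => ENNReal.tsum_le_tsum (ite_fcfm_eq_le _ x w)
    _ ≤ ∑' l, ∑' v, ((if l ++ [v] = w.1 then f l * μ v else 0) +
          ∑ u ∈ (G.nbhd w.1.toFinset)ᶜ, ∑ k ∈ Finset.range (w.1.length + 1),
            if l = w.1.take k ++ u :: w.1.drop k then
              if v ∈ G.freshNbhd (w.1.take k).toFinset u then f l * μ v else 0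
            else 0) :=
        ENNReal.tsum_comp_le_tsum_of_injective Subtype.val_injective _
    _ = _ := by
        simp only [ENNReal.tsum_add]
        congr 1
        rw [ENNReal.tsum_comm]
        simp only [Summable.tsum_finsetSum fun _ _ => ENNReal.summable, tsum_ite_eq, prob,
          Finset.mul_sum, tsum_fintype, Finset.sum_ite_mem, Finset.univ_inter]

variable (hn : ∀ v, prob μ (G.nbhd {v}) ≠ 0)
include hn

theorem prob_nbhd_insert_ne_zero (S : Finset V) (x : V) : prob μ (G.nbhd (insert x S)) ≠ 0 :=
  fun h => hn x (le_zero_iff.1 (h.subst (prob_mono μ (nbhd_mono (by simp)))))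

theorem prob_nbhd_insert_mul_letterWeight (S : Finset V) (x : V) :
    prob μ (G.nbhd (insert x S)) * G.letterWeight μ S x = μ x :=
  ENNReal.mul_div_cancel (prob_nbhd_insert_ne_zero hn S x) (prob_ne_top μ _)

theorem prob_sdiff_mul_listWeight_cons (u : V) (S : Finset V) (w : List V) :
    listWeight (G.letterWeight μ) S (u :: w) * prob μ (G.freshNbhd S u) +
      prob μ (G.nbhd S) * listWeight (G.letterWeight μ) S (u :: w) =
      μ u * listWeight (G.letterWeight μ) (insert u S) w := by
  rw [mul_comm, ← add_mul, freshNbhd, prob, prob,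
    Finset.sum_sdiff (nbhd_mono (Finset.subset_insert u S)), ← prob, listWeight, ← mul_assoc,
    prob_nbhd_insert_mul_letterWeight hn]

theorem sum_listWeight_insert (u : V) (S : Finset V) (w : List V) :
    ∑ k ∈ Finset.range (w.length + 1), listWeight (G.letterWeight μ) S (w.take k ++ u :: w.drop k) *
        prob μ (G.freshNbhd (S ∪ (w.take k).toFinset) u) +
      prob μ (G.nbhd S) * listWeight (G.letterWeight μ) S (u :: w) =
      μ u * listWeight (G.letterWeight μ) S w := by
  induction w generalizing S with
  | nil => simpa [listWeight] using prob_sdiff_mul_listWeight_cons hn u S []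
  | cons y w ih =>
    set c := G.letterWeight μ
    have hcons (k : ℕ) : S ∪ (List.take (k + 1) (y :: w)).toFinset =
        insert y S ∪ (List.take k w).toFinset := by
      rw [List.take_succ_cons, List.toFinset_cons, Finset.union_insert, Finset.insert_union]
    have hswap : μ u * listWeight c (insert u S) (y :: w) =
        c S y * (prob μ (G.nbhd (insert y S)) * listWeight c (insert y S) (u :: w)) := by
      rw [listWeight, ← mul_assoc, mul_letterWeight_insert_comm,
        ← prob_nbhd_insert_mul_letterWeight hn S y, listWeight, Finset.insert_comm]
      ring
    rw [List.length_cons, Finset.sum_range_succ', add_assoc]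
    simp only [hcons, List.take_zero, List.drop_zero, List.toFinset_nil, Finset.union_empty,
      List.nil_append]
    rw [prob_sdiff_mul_listWeight_cons hn, hswap]
    simp only [List.take_succ_cons, List.drop_succ_cons, List.cons_append,
      listWeight_cons c S y, mul_assoc]
    rw [← Finset.mul_sum, ← mul_add, ih (insert y S), mul_left_comm]

theorem tsum_listWeight_append_le (w : List V) :
    ∑' l, ∑' v, (if l ++ [v] = w then listWeight (G.letterWeight μ) ∅ l * μ v else 0) ≤
      listWeight (G.letterWeight μ) ∅ w * prob μ (G.nbhd w.toFinset) := by
  obtain rfl | ⟨l, y, rfl⟩ := List.eq_nil_or_concat' w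
  · simp
  · have hlast (l' : List V) (v : V) : l' ++ [v] = l ++ [y] ↔ l' = l ∧ v = y := by simp
    simp only [hlast, ite_and]
    have hset : (l ++ [y]).toFinset = insert y l.toFinset := by
      rw [List.toFinset_append, Finset.union_comm, List.toFinset_cons, List.toFinset_nil,
        insert_empty_eq, Finset.singleton_union]
    rw [ENNReal.tsum_comm]
    simp only [tsum_ite_eq]
    rw [listWeight_append, hset, listWeight_cons, listWeight, mul_one, Finset.empty_union,
      mul_assoc, mul_comm _ (prob μ _), prob_nbhd_insert_mul_letterWeight hn]

theorem push_listWeight_le :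
    (chain G.fcfm μ).push (fun w => listWeight (G.letterWeight μ) ∅ w.1) ≤
      fun w => listWeight (G.letterWeight μ) ∅ w.1 := by
  intro w
  have hinsert (u : V) := sum_listWeight_insert hn u ∅ w.1
  simp only [Finset.empty_union, prob_nbhd_empty, zero_mul, add_zero] at hinsert
  refine (push_chain_fcfm_le _ w).trans ?_
  rw [Finset.sum_congr rfl fun u _ => hinsert u, ← Finset.sum_mul, mul_comm, ← prob]
  calc _ ≤ listWeight (G.letterWeight μ) ∅ w.1 * prob μ (G.nbhd w.1.toFinset) +
        listWeight (G.letterWeight μ) ∅ w.1 * prob μ (G.nbhd w.1.toFinset)ᶜ :=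
        add_le_add_left (tsum_listWeight_append_le hn w.1) _
    _ = listWeight (G.letterWeight μ) ∅ w.1 := by rw [← mul_add, prob_add_prob_compl, mul_one]

end ProductForm

theorem tsum_list {X : Type*} (f : List X → ℝ≥0∞) :
    ∑' l, f l = f [] + ∑' x, ∑' l, f (x :: l) := by
  have hinj : Function.Injective fun p : X × List X => p.1 :: p.2 := fun _ _ h =>
    Prod.ext (List.cons.inj h).1 (List.cons.inj h).2
  rw [ENNReal.tsum_eq_add_tsum_ite [], ← hinj.tsum_eq, ← ENNReal.tsum_prod]
  · simp only [reduceCtorEq, if_false]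
  · rintro (_ | ⟨x, l⟩) hl
    · exact absurd (if_pos rfl) hl
    · exact ⟨(x, l), rfl⟩

theorem inv_one_sub_mul_le {p a t : ℝ≥0∞} (h : p * t + a = t) : (1 - p)⁻¹ * a ≤ t := by
  have hiter (n : ℕ) : p ^ n * t + ∑ k ∈ Finset.range n, p ^ k * a = t := by
    induction n with
    | zero => simp
    | succ n ih =>
      rw [Finset.sum_range_succ, pow_succ, mul_assoc, add_comm (Finset.sum _ _), ← add_assoc,
        ← mul_add, h, ih]
  rw [← ENNReal.tsum_geometric, ← ENNReal.tsum_mul_right]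
  exact ENNReal.tsum_le_of_sum_range_le fun n => le_add_self.trans (hiter n).le

theorem mul_inv_one_sub_add_one (p : ℝ≥0∞) : p * (1 - p)⁻¹ + 1 = (1 - p)⁻¹ := by
  rw [← ENNReal.tsum_geometric, ← ENNReal.tsum_mul_left, add_comm]
  simpa only [pow_zero, pow_succ'] using
    (tsum_eq_zero_add' (f := fun n => p ^ n) ENNReal.summable).symm

section ListSum

/-- The total weight of all the words that follow the letters of `S`. -/
def listSum (c : Finset V → V → ℝ≥0∞) (S : Finset V) : ℝ≥0∞ := ∑' l, listWeight c S l

/-- The total weight of the letters of `S` as next letters. -/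
def repeatWeight (c : Finset V → V → ℝ≥0∞) (S : Finset V) : ℝ≥0∞ := ∑ x ∈ S, c S x

/-- The weights on words without repetition that account for the words with repetitions: a new
letter `x` comes with the geometric series of the total weight of the repetitions that may
follow it. -/
def freshWeight (c : Finset V → V → ℝ≥0∞) (S : Finset V) (x : V) : ℝ≥0∞ :=
  if x ∈ S then 0 else c S x * (1 - repeatWeight c (insert x S))⁻¹

theorem listWeight_ne_zero_of_freshWeight {c : Finset V → V → ℝ≥0∞} {S : Finset V} {l : List V}
    (h : listWeight (freshWeight c) S l ≠ 0) :
    listWeight c S l ≠ 0 ∧ l.Nodup ∧ ∀ x ∈ l, x ∉ S := by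
  induction l generalizing S with
  | nil => simp [listWeight]
  | cons x l ih =>
    obtain ⟨hx, hl⟩ := mul_ne_zero_iff.1 h
    obtain ⟨hweight, hnodup, hnotMem⟩ := ih hl
    obtain ⟨hxS, hx⟩ := (ite_ne_left_iff.1 hx)
    refine ⟨mul_ne_zero (left_ne_zero_of_mul hx.symm) hweight,
      List.nodup_cons.2 ⟨fun hxl => hnotMem x hxl (Finset.mem_insert_self x S), hnodup⟩, ?_⟩
    rintro y (_ | ⟨_, hy⟩)
    · exact hxS
    · exact fun hyS => hnotMem y hy (Finset.mem_insert_of_mem hyS)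

variable [Fintype V] (c : Finset V → V → ℝ≥0∞)

theorem listSum_eq (S : Finset V) : listSum c S = 1 + ∑ x, c S x * listSum c (insert x S) := by
  rw [listSum, tsum_list, tsum_fintype]
  simp only [listSum, listWeight, ENNReal.tsum_mul_left]

theorem listSum_le {R : Finset V → ℝ≥0∞} (hR : ∀ S, 1 + ∑ x, c S x * R (insert x S) ≤ R S)
    (S : Finset V) : listSum c S ≤ R S := by
  have htrunc (n : ℕ) : ∀ S, ∑' l, (if l.length < n then listWeight c S l else 0) ≤ R S := by
    induction n with
    | zero => simp
    | succ n ih =>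
      intro S
      refine le_trans ?_ (hR S)
      rw [tsum_list, tsum_fintype]
      simp only [List.length_nil, List.length_cons, Nat.zero_lt_succ, Nat.succ_lt_succ_iff, if_true,
        listWeight, ← mul_ite_zero, ENNReal.tsum_mul_left]
      gcongr
      exact ih _
  rw [listSum, ENNReal.tsum_eq_iSup_sum]
  refine iSup_le fun F => le_trans (Finset.sum_le_sum fun l hl => ?_)
    ((ENNReal.sum_le_tsum F).trans (htrunc (F.sup List.length + 1) S))
  rw [if_pos (Nat.lt_succ_of_le (Finset.le_sup hl))]

theorem sum_mul_insert_eq (S : Finset V) (F : Finset V → ℝ≥0∞) :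
    ∑ x, c S x * F (insert x S) =
      repeatWeight c S * F S + ∑ x ∈ Sᶜ, c S x * F (insert x S) := by
  rw [← Finset.sum_add_sum_compl S, repeatWeight, Finset.sum_mul]
  congr 1
  exact Finset.sum_congr rfl fun x hx => by rw [Finset.insert_eq_of_mem hx]

theorem listSum_freshWeight_eq (S : Finset V) :
    listSum (freshWeight c) S = 1 + ∑ x ∈ Sᶜ, c S x *
      ((1 - repeatWeight c (insert x S))⁻¹ * listSum (freshWeight c) (insert x S)) := by
  have hrepeat : repeatWeight (freshWeight c) S = 0 :=
    Finset.sum_eq_zero fun x hx => if_pos hx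
  rw [listSum_eq, sum_mul_insert_eq, hrepeat, zero_mul, zero_add]
  congr 1
  refine Finset.sum_congr rfl fun x hx => ?_
  rw [freshWeight, if_neg (Finset.mem_compl.1 hx), mul_assoc]

theorem listSum_eq_mul_listSum_freshWeight (S : Finset V) :
    listSum c S = (1 - repeatWeight c S)⁻¹ * listSum (freshWeight c) S := by
  induction S using WellFoundedGT.induction with
  | ind S ih =>
    apply le_antisymm
    · refine listSum_le c (R := fun S => (1 - repeatWeight c S)⁻¹ * listSum (freshWeight c) S)
        (fun S => le_of_eq ?_) S
      rw [sum_mul_insert_eq c S fun S => (1 - repeatWeight c S)⁻¹ * listSum (freshWeight c) S,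
        add_left_comm, ← listSum_freshWeight_eq, ← mul_assoc, ← add_one_mul,
        mul_inv_one_sub_add_one]
    · refine inv_one_sub_mul_le ?_
      have hsum : ∑ x ∈ Sᶜ, c S x * ((1 - repeatWeight c (insert x S))⁻¹ *
          listSum (freshWeight c) (insert x S)) = ∑ x ∈ Sᶜ, c S x * listSum c (insert x S) :=
        Finset.sum_congr rfl fun x hx => by
          rw [← ih (insert x S) (Finset.ssubset_insert (Finset.mem_compl.1 hx))]
      rw [listSum_freshWeight_eq, hsum, add_left_comm, ← sum_mul_insert_eq, ← listSum_eq]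

end ListSum

theorem toFinset_ofFn_enum (I : Finset V) (σ : Equiv.Perm (Fin #I)) :
    (List.ofFn fun j => enum I (σ j)).toFinset = I := by
  ext v
  rw [List.mem_toFinset, List.mem_ofFn]
  exact ⟨fun ⟨j, hj⟩ => hj ▸ (I.equivFin.symm (σ j)).2,
    fun hv => ⟨σ.symm (I.equivFin ⟨v, hv⟩), by simp [enum]⟩⟩

theorem enum_injective (I : Finset V) : Function.Injective (enum I) :=
  Subtype.val_injective.comp I.equivFin.symm.injective

theorem ofFn_enum_injective : Function.Injective
    fun p : (I : Finset V) × Equiv.Perm (Fin #I) => List.ofFn fun j => enum p.1 (p.2 j) := by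
  rintro ⟨I, σ⟩ ⟨J, τ⟩ h
  obtain rfl : I = J := by
    rw [← toFinset_ofFn_enum I σ, ← toFinset_ofFn_enum J τ]
    exact congrArg List.toFinset h
  rw [Sigma.mk.injEq, heq_eq_eq]
  exact ⟨rfl, Equiv.ext fun j => enum_injective I (congrFun (List.ofFn_injective h) j)⟩

theorem exists_perm_ofFn_enum_eq {l : List V} (hl : l.Nodup) :
    ∃ σ : Equiv.Perm (Fin #l.toFinset), (List.ofFn fun j => enum l.toFinset (σ j)) = l := by
  have hcard := List.toFinset_card_of_nodup hl
  let index (j : Fin #l.toFinset) : Fin #l.toFinset :=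
    l.toFinset.equivFin ⟨l.get (j.cast hcard), List.mem_toFinset.2 (l.get_mem _)⟩
  have hindex : Function.Injective index := fun i j hij => by
    simpa [index, hl.getElem_inj_iff, Fin.ext_iff] using hij
  refine ⟨Equiv.ofBijective index (Finite.injective_iff_bijective.1 hindex),
    List.ext_get (by simp [hcard]) fun n _ _ => ?_⟩
  simp [enum, index]

theorem tsum_list_eq_sum_perm [Fintype V] {f : List V → ℝ≥0∞} (hf : ∀ l, f l ≠ 0 → l.Nodup) :
    ∑' l, f l =
      ∑ I : Finset V, ∑ σ : Equiv.Perm (Fin #I), f (List.ofFn fun j => enum I (σ j)) := by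
  rw [← ofFn_enum_injective.tsum_eq, ENNReal.tsum_sigma']
  · simp only [tsum_fintype]
  · intro l hl
    obtain ⟨σ, hσ⟩ := exists_perm_ofFn_enum_eq (hf l hl)
    exact ⟨⟨l.toFinset, σ⟩, hσ⟩

section Normalisation

/-- The set `S` is independent up to self-loops: no two distinct elements of `S` are adjacent. -/
def LooseIndep (G : Multigraph V) (S : Finset V) : Prop :=
  ∀ u ∈ S, ∀ v ∈ S, u ≠ v → ¬ G.Adj u v

theorem LooseIndep.mono {S T : Finset V} (hT : G.LooseIndep T) (hST : S ⊆ T) : G.LooseIndep S :=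
  fun u hu v hv => hT u (hST hu) v (hST hv)

theorem IsQueueDetail.looseIndep_toFinset {w : List V} (hw : G.IsQueueDetail w) :
    G.LooseIndep w.toFinset := fun u hu v hv huv hadj =>
  mul_ne_zero (List.count_pos_iff.2 (List.mem_toFinset.1 hu)).ne'
    (List.count_pos_iff.2 (List.mem_toFinset.1 hv)).ne' (hw.1 u v huv hadj)

theorem IsQueueDetail.sublist {w w' : List V} (hw : G.IsQueueDetail w) (h : w'.Sublist w) :
    G.IsQueueDetail w' :=
  ⟨fun u v huv hadj => Nat.le_zero.1
    ((Nat.mul_le_mul (h.count_le u) (h.count_le v)).trans (hw.1 u v huv hadj).le),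
    fun u hu => (h.count_le u).trans (hw.2 u hu)⟩

variable [Fintype V]

theorem mem_maxSubgraphIndepSets {I : Finset V} :
    I ∈ G.maxSubgraphIndepSets ↔ I.Nonempty ∧ G.LooseIndep I := by
  simp only [maxSubgraphIndepSets, Finset.mem_filter_univ, LooseIndep, SimpleGraph.IsIndepSet,
    Set.Pairwise, Finset.mem_coe, maxSubgraph]
  exact and_congr_right fun _ => ⟨fun h u hu v hv huv hadj => h hu hv huv ⟨huv, hadj⟩,
    fun h u hu v hv huv hadj => h u hu v hv huv hadj.2⟩

theorem isQueueDetail_append_singleton {w : List V} {v : V} :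
    G.IsQueueDetail (w ++ [v]) ↔ G.IsQueueDetail w ∧ v ∉ G.nbhd w.toFinset := by
  refine ⟨fun h => ⟨h.sublist (List.sublist_append_left w [v]), ?_⟩, fun ⟨hw, hv⟩ => ?_⟩
  · simpa using h.notMem_nbhd
  · have hstore : ¬ ∃ u ∈ w, G.Adj u v := by simpa [mem_nbhd] using hv
    simpa [fcfmWord, hstore] using hw.fcfmWord v

/-- The factor of a letter `x` preceded by the letters of `S` in the product-form weight of a word,
set to `0` if the word is not admissible. -/
def admissibleWeight (G : Multigraph V) (μ : PMF V) (S : Finset V) (x : V) : ℝ≥0∞ :=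
  if x ∈ G.nbhd S then 0 else G.letterWeight μ S x

theorem listWeight_admissibleWeight (μ : PMF V) (w : List V) :
    listWeight (G.admissibleWeight μ) ∅ w =
      if G.IsQueueDetail w then listWeight (G.letterWeight μ) ∅ w else 0 := by
  induction w using List.reverseRecOn with
  | nil => exact (if_pos G.emptyDetail.2).symm
  | append_singleton w x ih =>
    simp only [listWeight_append, ih, isQueueDetail_append_singleton, listWeight, admissibleWeight,
      Finset.empty_union, mul_one, ite_and]
    split_ifs <;> simp

theorem tsum_queueDetail_eq_listSum (μ : PMF V) :
    ∑' w : G.QueueDetail, listWeight (G.letterWeight μ) ∅ w.1 =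
      listSum (G.admissibleWeight μ) ∅ := by
  simp only [listSum, listWeight_admissibleWeight]
  exact tsum_subtype {w | G.IsQueueDetail w} (listWeight (G.letterWeight μ) ∅)

theorem looseIndep_of_listWeight_ne_zero {μ : PMF V} {w : List V}
    (h : listWeight (G.admissibleWeight μ) ∅ w ≠ 0) : G.LooseIndep w.toFinset := by
  rw [listWeight_admissibleWeight] at h
  exact (ite_ne_right_iff.1 h).1.looseIndep_toFinset

theorem LooseIndep.sdiff_nbhd {S : Finset V} (hS : G.LooseIndep S) :
    S \ G.nbhd S = S ∩ G.loopless := by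
  ext x
  simp only [Finset.mem_sdiff, Finset.mem_inter, mem_nbhd, loopless, Finset.mem_filter_univ]
  refine and_congr_right fun hx => not_congr ⟨?_, fun hloop => ⟨x, hx, hloop⟩⟩
  rintro ⟨u, hu, hux⟩
  obtain rfl | hne := eq_or_ne u x
  · exact hux
  · exact absurd hux (hS u hu x hx hne)

theorem repeatWeight_admissibleWeight (μ : PMF V) {S : Finset V} (hS : G.LooseIndep S) :
    repeatWeight (G.admissibleWeight μ) S = prob μ (S ∩ G.loopless) / prob μ (G.nbhd S) := by
  rw [← hS.sdiff_nbhd, prob, Finset.sdiff_eq_filter, Finset.sum_filter, div_eq_mul_inv,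
    Finset.sum_mul]
  refine Finset.sum_congr rfl fun x hx => ?_
  rw [admissibleWeight, letterWeight, Finset.insert_eq_of_mem hx]
  split_ifs <;> simp [div_eq_mul_inv]

theorem freshWeight_admissibleWeight {μ : PMF V} {S : Finset V} {x : V}
    (hn : prob μ (G.nbhd (insert x S)) ≠ 0) (hx : x ∉ S) (hS : G.LooseIndep (insert x S)) :
    freshWeight (G.admissibleWeight μ) S x =
      μ x / (prob μ (G.nbhd (insert x S)) - prob μ (insert x S ∩ G.loopless)) := by
  have hadm : x ∉ G.nbhd S := fun h =>
    have ⟨u, hu, hux⟩ := mem_nbhd.1 h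
    hS u (Finset.mem_insert_of_mem hu) x (Finset.mem_insert_self x S) (ne_of_mem_of_not_mem hu hx)
      hux
  rw [freshWeight, if_neg hx, admissibleWeight, if_neg hadm, repeatWeight_admissibleWeight μ hS,
    letterWeight]
  have hn' := prob_ne_top μ (G.nbhd (insert x S))
  rw [← ENNReal.div_self hn hn', ← ENNReal.sub_div fun _ _ => hn,
    ENNReal.inv_div (.inl hn') (.inl hn), ← mul_div_assoc, ENNReal.div_mul_cancel hn hn']

theorem listWeight_freshWeight_ofFn {μ : PMF V} (hn : ∀ v, prob μ (G.nbhd {v}) ≠ 0) {n : ℕ}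
    {x : Fin n → V} (hinj : Function.Injective x) (hx : G.LooseIndep (List.ofFn x).toFinset) :
    listWeight (freshWeight (G.admissibleWeight μ)) ∅ (List.ofFn x) =
      ∏ i, μ (x i) / (prob μ (G.nbhd (firsts x i)) - prob μ (firsts x i ∩ G.loopless)) := by
  rw [listWeight_ofFn]
  refine Finset.prod_congr rfl fun i _ => ?_
  have hfresh : x i ∉ (Finset.Iio i).image x := by simp [hinj.eq_iff]
  have hsub : insert (x i) ((Finset.Iio i).image x) ⊆ (List.ofFn x).toFinset := by
    simp [Finset.insert_subset_iff, Finset.image_subset_iff]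
  rw [Finset.empty_union, freshWeight_admissibleWeight (prob_nbhd_insert_ne_zero hn _ _) hfresh
    (hx.mono hsub), insert_image_Iio]

theorem listSum_admissibleWeight_empty {μ : PMF V} (hn : ∀ v, prob μ (G.nbhd {v}) ≠ 0) :
    listSum (G.admissibleWeight μ) ∅ = 1 + ∑ I ∈ G.maxSubgraphIndepSets,
      ∑ σ : Equiv.Perm (Fin #I), ∏ i, μ (enum I (σ i)) /
        (prob μ (G.nbhd (firsts (fun j => enum I (σ j)) i)) -
          prob μ (firsts (fun j => enum I (σ j)) i ∩ G.loopless)) := by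
  rw [listSum_eq_mul_listSum_freshWeight, repeatWeight, Finset.sum_empty, tsub_zero, inv_one,
    one_mul, listSum, tsum_list_eq_sum_perm fun l hl => (listWeight_ne_zero_of_freshWeight hl).2.1]
  have hempty : ∅ ∉ G.maxSubgraphIndepSets := fun h => (mem_maxSubgraphIndepSets.1 h).1.ne_empty rfl
  rw [← Finset.sum_subset (Finset.subset_univ (insert ∅ G.maxSubgraphIndepSets)),
    Finset.sum_insert hempty]
  · congr 1
    · exact Fintype.sum_subsingleton (ι := Equiv.Perm (Fin 0)) _ 1
    · refine Finset.sum_congr rfl fun I hI => Finset.sum_congr rfl fun σ _ => ?_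
      refine listWeight_freshWeight_ofFn hn ((enum_injective I).comp σ.injective) ?_
      rw [toFinset_ofFn_enum]
      exact (mem_maxSubgraphIndepSets.1 hI).2
  · refine fun I _ hI => Finset.sum_eq_zero fun σ _ => ?_
    contrapose! hI
    rw [Finset.mem_insert, mem_maxSubgraphIndepSets, ← toFinset_ofFn_enum I σ]
    exact (Finset.eq_empty_or_nonempty _).imp id fun h =>
      ⟨h, looseIndep_of_listWeight_ne_zero (listWeight_ne_zero_of_freshWeight hI).1⟩

end Normalisation

section Stability

theorem firsts_enum_subset (I : Finset V) (σ : Equiv.Perm (Fin #I)) (i : Fin #I) :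
    firsts (fun j => enum I (σ j)) i ⊆ I :=
  Finset.image_subset_iff.2 fun _ _ => (I.equivFin.symm _).2

theorem firsts_nonempty {n : ℕ} (x : Fin n → V) (i : Fin n) : (firsts x i).Nonempty :=
  Finset.nonempty_Iic.image x

variable [Fintype V] {μ : PMF V}

theorem prob_nbhd_singleton_ne_zero (hμ : μ ∈ G.Ncond) (v : V) : prob μ (G.nbhd {v}) ≠ 0 := by
  by_cases hloop : G.Adj v v
  · exact fun h => mem_exactSupport_iff.1 hμ.1 v (Finset.sum_eq_zero_iff.1 h v
      (mem_nbhd.2 ⟨v, Finset.mem_singleton_self v, hloop⟩))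
  · have hindep : {v} ∈ G.indepSets := by simpa [indepSets] using hloop
    exact (mass_lt_mass_iff.1 (hμ.2 _ hindep)).ne_bot

theorem exists_adj (hμ : μ ∈ G.Ncond) (v : V) : ∃ u, G.Adj v u := by
  obtain ⟨u, hu, -⟩ := Finset.exists_ne_zero_of_sum_ne_zero (prob_nbhd_singleton_ne_zero hμ v)
  obtain ⟨w, hw, hwu⟩ := mem_nbhd.1 hu
  exact ⟨u, Finset.mem_singleton.1 hw ▸ hwu⟩

theorem LooseIndep.prob_inter_loopless_lt (hμ : μ ∈ G.Ncond) {S : Finset V} (hS : G.LooseIndep S)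
    (hne : S.Nonempty) : prob μ (S ∩ G.loopless) < prob μ (G.nbhd S) := by
  rcases (S ∩ G.loopless).eq_empty_or_nonempty with hempty | hloopless
  · obtain ⟨v, hv⟩ := hne
    rw [hempty, prob, Finset.sum_empty, pos_iff_ne_zero, ← Finset.insert_eq_of_mem hv]
    exact prob_nbhd_insert_ne_zero (prob_nbhd_singleton_ne_zero hμ) S v
  · have hindep : S ∩ G.loopless ∈ G.indepSets := by
      refine (Finset.mem_filter_univ _).2 ⟨hloopless, fun u hu v hv => ?_⟩
      obtain rfl | huv := eq_or_ne u v
      · exact (Finset.mem_filter.1 (Finset.mem_inter.1 hu).2).2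
      · exact hS u (Finset.mem_inter.1 hu).1 v (Finset.mem_inter.1 hv).1 huv
    exact (mass_lt_mass_iff.1 (hμ.2 _ hindep)).trans_le
      (prob_mono μ (nbhd_mono Finset.inter_subset_left))

theorem prob_firsts_inter_loopless_lt (hμ : μ ∈ G.Ncond) {I : Finset V}
    (hI : I ∈ G.maxSubgraphIndepSets) (σ : Equiv.Perm (Fin #I)) (i : Fin #I) :
    prob μ (firsts (fun j => enum I (σ j)) i ∩ G.loopless) <
      prob μ (G.nbhd (firsts (fun j => enum I (σ j)) i)) :=
  ((mem_maxSubgraphIndepSets.1 hI).2.mono (firsts_enum_subset I σ i)).prob_inter_loopless_lt hμ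
    (firsts_nonempty _ i)

theorem listSum_admissibleWeight_ne_top (hμ : μ ∈ G.Ncond) :
    listSum (G.admissibleWeight μ) ∅ ≠ ∞ := by
  rw [listSum_admissibleWeight_empty (prob_nbhd_singleton_ne_zero hμ)]
  exact ENNReal.add_ne_top.2 ⟨ENNReal.one_ne_top, ENNReal.sum_ne_top.2 fun I hI =>
    ENNReal.sum_ne_top.2 fun σ _ => ENNReal.prod_ne_top fun i _ => ENNReal.div_ne_top
      (μ.apply_ne_top _) (tsub_pos_of_lt (prob_firsts_inter_loopless_lt hμ hI σ i)).ne'⟩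

theorem toReal_listSum_admissibleWeight (hμ : μ ∈ G.Ncond) :
    (listSum (G.admissibleWeight μ) ∅).toReal = (G.normConst μ)⁻¹ := by
  have htop := listSum_admissibleWeight_ne_top hμ
  rw [listSum_admissibleWeight_empty (prob_nbhd_singleton_ne_zero hμ)] at htop ⊢
  have hI := ENNReal.sum_ne_top.1 (ENNReal.add_ne_top.1 htop).2
  rw [normConst, inv_inv, ENNReal.toReal_add ENNReal.one_ne_top (ENNReal.add_ne_top.1 htop).2,
    ENNReal.toReal_one, ENNReal.toReal_sum hI]
  refine congrArg _ (Finset.sum_congr rfl fun I hI' => ?_)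
  rw [ENNReal.toReal_sum (ENNReal.sum_ne_top.1 (hI I hI'))]
  refine Finset.sum_congr rfl fun σ _ => ?_
  rw [ENNReal.toReal_prod]
  refine Finset.prod_congr rfl fun i _ => ?_
  rw [ENNReal.toReal_div, ENNReal.toReal_sub_of_le
    (prob_firsts_inter_loopless_lt hμ hI' σ i).le (prob_ne_top _ _), toReal_prob, toReal_prob]

theorem listWeight_letterWeight_ne_zero (hμ : ∀ v, μ v ≠ 0) (S : Finset V) (w : List V) :
    listWeight (G.letterWeight μ) S w ≠ 0 := by
  induction w generalizing S with
  | nil => exact one_ne_zero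
  | cons x w ih => exact mul_ne_zero (ENNReal.div_ne_zero.2 ⟨hμ x, prob_ne_top μ _⟩) (ih _)

theorem tsum_listWeight_letterWeight_ne_zero (μ : PMF V) :
    ∑' w : G.QueueDetail, listWeight (G.letterWeight μ) ∅ w.1 ≠ 0 := fun h =>
  one_ne_zero (ENNReal.tsum_eq_zero.1 h G.emptyDetail)

theorem tsum_listWeight_letterWeight_ne_top (hμ : μ ∈ G.Ncond) :
    ∑' w : G.QueueDetail, listWeight (G.letterWeight μ) ∅ w.1 ≠ ∞ :=
  tsum_queueDetail_eq_listSum (G := G) μ ▸ listSum_admissibleWeight_ne_top hμ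

/-- The probability on the queue details that is proportional to the product-form weight. -/
def productPMF (hμ : μ ∈ G.Ncond) : PMF G.QueueDetail :=
  .normalize (fun w => listWeight (G.letterWeight μ) ∅ w.1)
    (tsum_listWeight_letterWeight_ne_zero μ) (tsum_listWeight_letterWeight_ne_top hμ)

theorem toReal_productPMF (hμ : μ ∈ G.Ncond) (w : G.QueueDetail) :
    (productPMF hμ w).toReal = G.normConst μ * G.wordWeight μ w.1 := by
  rw [productPMF, PMF.normalize_apply, tsum_queueDetail_eq_listSum, ENNReal.toReal_mul,
    ENNReal.toReal_inv, toReal_listSum_admissibleWeight hμ, inv_inv,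
    toReal_listWeight_letterWeight, mul_comm]

theorem productPMF_ne_zero (hμ : μ ∈ G.Ncond) (w : G.QueueDetail) : productPMF hμ w ≠ 0 := by
  rw [productPMF, PMF.normalize_apply]
  exact mul_ne_zero (listWeight_letterWeight_ne_zero (mem_exactSupport_iff.1 hμ.1) ∅ w.1)
    (ENNReal.inv_ne_zero.2 (tsum_listWeight_letterWeight_ne_top hμ))

theorem isStationary_productPMF (hμ : μ ∈ G.Ncond) :
    IsStationary G.fcfm μ (productPMF hμ) := by
  refine isStationary_iff_invariant.2 (MarkovChain.invariant_of_push_le ?_ fun w => ?_)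
  · rw [PMF.tsum_coe]
    exact ENNReal.one_ne_top
  · simp only [productPMF, PMF.normalize_apply, MarkovChain.push,
      mul_right_comm _ _ (chain _ _ _ _), ENNReal.tsum_mul_right]
    exact mul_le_mul_left (push_listWeight_le (prob_nbhd_singleton_ne_zero hμ) w) _

theorem IsStationary.eq_productPMF (hμ : μ ∈ G.Ncond) {π : PMF G.QueueDetail}
    (hπ : IsStationary G.fcfm μ π) : π = productPMF hμ :=
  MarkovChain.Invariant.unique
    (reachable_emptyDetail (mem_exactSupport_iff.1 hμ.1) (exists_adj hμ))
    (isStationary_iff_invariant.1 hπ) (isStationary_iff_invariant.1 (isStationary_productPMF hμ))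

end Stability

end Multigraph

end

theorem mainTheorem1_general {V : Type*} [Fintype V] [MeasurableSpace V]
    [MeasurableSingletonClass V] (G : Multigraph V) :
    G.Stab G.fcfm = G.Ncond ∧
    ∀ μ ∈ G.Ncond, ∃ π : PMF G.QueueDetail,
      Multigraph.IsStationary G.fcfm μ π ∧
      (∀ π' : PMF G.QueueDetail, Multigraph.IsStationary G.fcfm μ π' → π' = π) ∧
      ∀ w : G.QueueDetail, (π w).toReal = G.normConst μ * G.wordWeight μ w.1 :=
  ⟨Set.Subset.antisymm
    (fun _ ⟨hsupp, hrec⟩ => ⟨hsupp, fun _ hI =>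
      Multigraph.mass_lt_of_positiveRecurrent (Multigraph.mem_exactSupport_iff.1 hsupp) hrec hI⟩)
    (fun _ hμ => ⟨hμ.1, (Multigraph.isStationary_productPMF hμ).positiveRecurrent
      (Multigraph.productPMF_ne_zero hμ)⟩),
  fun _ hμ => ⟨Multigraph.productPMF hμ, Multigraph.isStationary_productPMF hμ,
    fun _ hπ' => hπ'.eq_productPMF hμ, Multigraph.toReal_productPMF hμ⟩⟩

theorem mainTheorem1 {V : Type*} [Fintype V] [MeasurableSpace V] [MeasurableSingletonClass V]
    (G : Multigraph V) (hconn : G.Connected) (hbip : ¬ G.IsBipartiteGraph) :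
    G.Stab G.fcfm = G.Ncond ∧
    ∀ μ ∈ G.Ncond, ∃ π : PMF G.QueueDetail,
      Multigraph.IsStationary G.fcfm μ π ∧
      (∀ π' : PMF G.QueueDetail, Multigraph.IsStationary G.fcfm μ π' → π' = π) ∧
      ∀ w : G.QueueDetail, (π w).toReal = G.normConst μ * G.wordWeight μ w.1 :=
  mainTheorem1_general G
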